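/- **Setting.** For a real Hilbert space $\mathcal H$ and $g:\mathcal H\to\,]-\infty,+\infty]$ let $\operatorname{dom} g=\{g<+\infty\}$, $\operatorname{epi} g=\{(x,\delta)\in\mathcal H\oplus\mathbb R : g(x)\le\delta\}$, $g^*(u)=\sup_x(\langle x,u\rangle-g(x))$, and let $\operatorname{prox}_g(x)$ be the unique minimizer of $y\mapsto g(y)+\frac12\|x-y\|^2$. $\Gamma_0(\mathcal H)$ is the class of proper lower semicontinuous convex functions $\mathcal H\to\,]-\infty,+\infty]$. For a set $C$, $\iota_C$ is its indicator function ($0$ on $C$, $+\infty$ elsewhere) and $P_C=\operatorname{prox}_{\iota_C}$ is the projection onto $C$. For $g\in\Gamma_0(\mathcal H)$, $(\operatorname{rec} g)(x)=\lim_{t\to+\infty}(g(x_0+tx)-g(x_0))/t$ for any $x_0\in\operatorname{dom} g$, and the perspective $\widetilde g:\mathcal H\oplus\mathbb R\to\,]-\infty,+\infty]$ is $\widetilde g(x,\eta)=\eta\, g(x/\eta)$ if $\eta>0$, $(\operatorname{rec} g)(x)$ if $\eta=0$, $+\infty$ if $\eta<0$. **Statement.** Let $f:\mathbb R\to\,]-\infty,+\infty]$,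 $f(\xi)=\frac{\xi}{1-\xi}$ if $\xi<1$ and $f(\xi)=+\infty$ otherwise. All proximity operators and projections below are well defined everywhere, and the following hold. 1. $f\in\Gamma_0(\mathbb R)$; for every $x_0\in\operatorname{dom} f$ and every $x$ the limit defining $(\operatorname{rec} f)(x)$ exists and does not depend on $x_0$, and $\operatorname{rec} f=\iota_{]-\infty,0]}$. Moreover $\widetilde f(x,\eta)=\frac{\eta x}{\eta-x}$ if $\eta>0$ and $x<\eta$; $\widetilde f(x,0)=\iota_{]-\infty,0]}(x)$; and $\widetilde f(x,\eta)=+\infty$ otherwise. 2. $D:=\overline{\operatorname{dom}}\,\widetilde f=\{(x,\eta):\eta\ge0,\ x\le\eta\}$, and $$P_D(x,\eta)=\begin{cases}(\min\{0,x\},0),&\eta\le0,\ x\le-\eta;\\ \big(\tfrac{x+\eta}2,\tfrac{x+\eta}2\big),&|\eta|\le x;\\(x,\eta),&\text{otherwise.}\end{cases}$$ Also $\widetilde f(P_D(x,\eta))$ equals $0$ if $\eta\le0$ and $x\le-\eta$; $\frac{\eta x}{\eta-x}$ if $\eta\ge0$ and $x<\eta$; and $+\infty$ otherwise. Hence, for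 $\delta\in\mathbb R$, $\widetilde f(P_D(x,\eta))\le\delta$ if and only if ($\eta\ge0$, $x<\eta$ and $\frac{\eta x}{\eta-x}\le\delta$) or ($\eta\le0$, $x\le-\eta$ and $0\le\delta$). 3. For every $(x,\eta,\delta)\in\mathbb R^3$, $$P_{\operatorname{epi}\widetilde f}(x,\eta,\delta)=\begin{cases}(\min\{0,x\},0,\delta),&\eta\le0,\ x\le-\eta,\ 0\le\delta;\\(x,\eta,\delta),&\eta\ge0,\ x<\eta,\ \frac{\eta x}{\eta-x}\le\delta;\\ \big(\operatorname{prox}_{\mu\widetilde f}(x,\eta),\delta+\mu\big),&\text{otherwise,}\end{cases}$$ where, in the last case, $\mu$ is the unique strictly positive solution of $\mu+\delta-\widetilde f(\operatorname{prox}_{\mu\widetilde f}(x,\eta))=0$; it satisfies $\mu\le-\delta+\frac{\eta x}{\eta-x}$ if $\eta\ge0$ and $x<\eta$, and $\mu\le-\delta$ if $\eta<0$ and $x\le-\eta$. 4. $f^*(\xi)=(\sqrt\xi-1)^2$ if $\xi\ge0$ and $f^*(\xi)=+\infty$ if $\xi<0$; $\overline{\operatorname{dom}}\,f^*=[0,+\infty[$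 and $P_{\overline{\operatorname{dom}}f^*}(\xi)=\max\{0,\xi\}$; thus $f^*(P_{\overline{\operatorname{dom}}f^*}\,\xi)$ equals $(\sqrt\xi-1)^2$ if $\xi\ge0$ and $1$ if $\xi<0$. 5. For all $\gamma>0$ and $x\in\mathbb R$: $\operatorname{prox}_{\gamma f}(x)$ is the unique solution $p\in\,]-\infty,1[$ of $(x-p)(1-p)^2-\gamma=0$, and $\operatorname{prox}_{\gamma f^*}(x)$ is the unique solution $q\in\,]\max\{x-\gamma,0\},+\infty[$ of $q^3+2(\gamma-x)q^2+q(\gamma-x)^2-\gamma^2=0$. 6. Let $\mu>0$, $(x,\eta)\in\mathbb R^2$ and $\beta:=\eta+(\sqrt{\max\{0,x\}}-\sqrt\mu)^2$. Then $\eta+\mu f^*(P_{\overline{\operatorname{dom}}f^*}(x/\mu))\le0$ if and only if $\beta\le0$. If $\beta\le0$, then $\operatorname{prox}_{\mu\widetilde f}(x,\eta)=(\min\{0,x\},0)$ and $\widetilde f(\operatorname{prox}_{\mu\widetilde f}(x,\eta))=0$. If $\beta>0$, there is a unique $\nu>0$ such that $$\nu=\eta+\mu f^*\big(\operatorname{prox}_{\frac\nu\mu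 f^*}(\tfrac x\mu)\big)=\eta+\mu\Big(\sqrt{\operatorname{prox}_{\frac\nu\mu f^*}(\tfrac x\mu)}-1\Big)^2;$$ it satisfies $\nu\le\beta$, and $$\operatorname{prox}_{\mu\widetilde f}(x,\eta)=\Big(x-\mu\operatorname{prox}_{\frac\nu\mu f^*}(\tfrac x\mu),\ \nu\Big),\qquad \widetilde f\big(\operatorname{prox}_{\mu\widetilde f}(x,\eta)\big)=\nu\,\frac{p}{1-p}\quad\text{with } p=\operatorname{prox}_{\frac\mu\nu f}(\tfrac x\nu).$$ -/

import Mathlib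

open Filter Topology

noncomputable section

namespace HypCone

/-- The indicator function `ι_C`: zero on `C`, `+∞` outside `C`. -/
def indicator {E : Type*} (C : Set E) (x : E) : EReal :=
  open Classical in if x ∈ C then 0 else ⊤

/-- The effective domain of an extended-real-valued function. -/
def dom {E : Type*} (f : E → EReal) : Set E := {x | f x < ⊤}

/-- The epigraph of `f`, as a subset of the Hilbert direct sum `E ⊕ ℝ`. -/
def epi {E : Type*} (f : E → EReal) : Set (WithLp 2 (E × ℝ)) :=
  {z | f z.fst ≤ (z.snd : EReal)}

variable {E : Type*} [NormedAddCommGroup E] [InnerProductSpace ℝ E]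

/-- The class `Γ₀(E)` of proper lower semicontinuous convex functions `E → ]-∞, +∞]`. -/
structure Gamma0 (f : E → EReal) : Prop where
  ne_bot : ∀ x, f x ≠ ⊥
  proper : (dom f).Nonempty
  lsc : LowerSemicontinuous f
  convex : Convex ℝ (epi f)

/-- The difference quotient `(f (x₀ + t x) - f x₀) / t`. -/
def diffQuot (f : E → EReal) (x₀ x : E) (t : ℝ) : EReal :=
  (f (x₀ + t • x) - f x₀) / (t : EReal)

/-- The recession function: `lim_{t → +∞} (f (x₀ + t x) - f x₀) / t` for any `x₀ ∈ dom f`.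
For `f ∈ Γ₀(E)` the limit exists and does not depend on `x₀`; the supremum over `x₀` and the upper
limit only make the definition total. -/
def recession (f : E → EReal) (x : E) : EReal :=
  ⨆ x₀ ∈ dom f, limsup (diffQuot f x₀ x) atTop

/-- The perspective of `f`, on the Hilbert direct sum `E ⊕ ℝ`. -/
def perspective (f : E → EReal) (z : WithLp 2 (E × ℝ)) : EReal :=
  if 0 < z.snd then (z.snd : EReal) * f (z.snd⁻¹ • z.fst)
  else if z.snd = 0 then recession f z.fst
  else ⊤

/-- The Fenchel conjugate. -/
def conjugate (f : E → EReal) (u : E) : EReal :=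
  ⨆ x : E, ((inner ℝ x u : ℝ) : EReal) - f x

/-- The function `γ f`, for a real `γ` (used for `γ > 0`). -/
def scale (γ : ℝ) (f : E → EReal) (x : E) : EReal := (γ : EReal) * f x

/-- The objective `y ↦ f y + ‖x - y‖² / 2` of the proximity operator at `x`. -/
def proxObj (f : E → EReal) (x y : E) : EReal :=
  f y + ((1 / 2 * ‖x - y‖ ^ 2 : ℝ) : EReal)

/-- `p` is the unique minimizer of `y ↦ f y + ‖x - y‖² / 2`. -/
def IsProx (f : E → EReal) (x p : E) : Prop :=
  ∀ y, y ≠ p → proxObj f x p < proxObj f x y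

/-- The proximity operator: the unique minimizer of `y ↦ f y + ‖x - y‖² / 2` (an arbitrary point if
there is no unique minimizer). -/
def prox (f : E → EReal) (x : E) : E := Classical.epsilon (IsProx f x)

theorem IsProx.prox_eq {F : Type*} [NormedAddCommGroup F] {f : F → EReal} {x p : F}
    (h : IsProx f x p) : prox f x = p := by
  have h' : IsProx f x (prox f x) := Classical.epsilon_spec (p := IsProx f x) ⟨p, h⟩
  by_contra hne
  exact lt_asymm (h _ hne) (h' _ (Ne.symm hne))

/-- The projection onto `C`, i.e. the proximity operator of the indicator function of `C`. -/
def proj (C : Set E) : E → E := prox (indicator C)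

/-- The point `(x, η)` of the Hilbert direct sum `ℝ ⊕ ℝ`. -/
def pt2 (x η : ℝ) : WithLp 2 (ℝ × ℝ) := WithLp.toLp 2 (x, η)

/-- The point `(z, δ)` of the Hilbert direct sum `(ℝ ⊕ ℝ) ⊕ ℝ`. -/
def pt3 (z : WithLp 2 (ℝ × ℝ)) (δ : ℝ) : WithLp 2 (WithLp 2 (ℝ × ℝ) × ℝ) := WithLp.toLp 2 (z, δ)

/-- The hyperbolic penalty `ξ ↦ ξ / (1 - ξ)` on `]-∞, 1[`, `+∞` elsewhere. -/
def hyp (ξ : ℝ) : EReal := if ξ < 1 then ((ξ / (1 - ξ) : ℝ) : EReal) else ⊤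

/-- The perspective of the hyperbolic penalty. -/
def hypPersp : WithLp 2 (ℝ × ℝ) → EReal := perspective hyp

/-- The conjugate of the hyperbolic penalty. -/
def hypConj : ℝ → EReal := conjugate hyp

end HypCone

end

open HypCone

namespace HypCone

/-! ### Proximity operators and projections through variational inequalities -/

section Prox

variable {E : Type*} [NormedAddCommGroup E] [InnerProductSpace ℝ E]

/-! The hyperbola is the envelope of its tangents. Parametrised by `s ≥ 0`, with slope `s ^ 2`,
these are `x * s ^ 2 - (s - 1) ^ 2`, so `f*(s ^ 2) = (s - 1) ^ 2`. On `η ≥ 0` the perspective is the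
supremum of the linear forms `x * s ^ 2 - η * (s - 1) ^ 2` (`hypPersp_le_iff`). Hence its epigraph
is an intersection of closed half-spaces, and one well-chosen `s` proves each subgradient
inequality.

Every proximal point is certified by a subgradient: `z - p ∈ ∂f(p)` makes `p` the unique minimizer,
the excess being at least `‖y - p‖ ^ 2 / 2` (`isProx_of_subgradient`). Existence then reduces to
solving scalar equations by the intermediate value theorem (`exists_prox_hyp_eq`,
`exists_prox_hypConj_eq`, `exists_perspProx_eq`), and a second root would give a second proximal
point.

The projection onto the epigraph exists by the Hilbert space projection theorem. If it raises the
height by `μ > 0`, its normal vector is `(z - p, -μ)`, which says that `p` is the proximal point of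
`z` for `μ f~`; otherwise `p` is the projection of `z` onto the closed domain
(`exists_isPerspProx_of_hypPersp_proj`). -/

theorem half_norm_sub_sq_eq (z p y : E) :
    1 / 2 * ‖z - y‖ ^ 2 =
      1 / 2 * ‖z - p‖ ^ 2 - inner ℝ (z - p) (y - p) + 1 / 2 * ‖y - p‖ ^ 2 := by
  have h : z - y = (z - p) - (y - p) := by abel
  rw [h, norm_sub_sq_real]
  ring

/-- A point at which `z - p` is a subgradient of `f` is the proximal point of `z`. -/
theorem isProx_of_subgradient {f : E → EReal} {z p : E} {a : ℝ} (hp : f p = a)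
    (h : ∀ y, ((a + inner ℝ (z - p) (y - p) : ℝ) : EReal) ≤ f y) : IsProx f z p := by
  intro y hy
  have h1 := h y
  have hpos : 0 < ‖y - p‖ := norm_pos_iff.2 (sub_ne_zero.2 hy)
  unfold proxObj
  rw [hp, ← EReal.coe_add]
  refine lt_of_lt_of_le ?_ (add_le_add_left h1 _)
  rw [← EReal.coe_add, EReal.coe_lt_coe_iff, half_norm_sub_sq_eq z p y]
  have : 0 < ‖y - p‖ ^ 2 := by positivity
  linarith

/-- Testing against real upper bounds `r` of `f y` keeps the subgradient inequality in `ℝ` and fits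
the tangent descriptions of the epigraphs. -/
theorem isProx_scale_of_subgradient {f : E → EReal} {z p : E} {a γ : ℝ} (hp : f p = a)
    (hγ : 0 < γ)
    (h : ∀ y (r : ℝ), f y ≤ r → γ * a + inner ℝ (z - p) (y - p) ≤ γ * r)
    (hbot : ∀ y, f y ≠ ⊥) : IsProx (scale γ f) z p := by
  refine isProx_of_subgradient (a := γ * a) (by simp [scale, hp]) fun y => ?_
  unfold scale
  have hb := hbot y
  have hr := h y
  generalize f y = v at hb hr ⊢
  induction v with
  | bot => exact absurd rfl hb
  | top => rw [EReal.coe_mul_top_of_pos hγ]; exact le_top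
  | coe r =>
    rw [← EReal.coe_mul, EReal.coe_le_coe_iff]
    exact hr r le_rfl

theorem isProx_indicator {C : Set E} {z p : E} (hp : p ∈ C)
    (h : ∀ y ∈ C, inner ℝ (z - p) (y - p) ≤ 0) : IsProx (indicator C) z p := by
  refine isProx_of_subgradient (a := 0) (by simp [indicator, hp]) fun y => ?_
  by_cases hy : y ∈ C
  · have := h y hy
    simp only [indicator, hy, if_true, zero_add]
    exact_mod_cast this
  · simp [indicator, hy]

theorem exists_variational_projection [CompleteSpace E] {C : Set E} (hne : C.Nonempty)
    (hcl : IsClosed C) (hc : Convex ℝ C) (z : E) :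
    ∃ p ∈ C, ∀ y ∈ C, inner ℝ (z - p) (y - p) ≤ 0 := by
  obtain ⟨p, hp, hmin⟩ := exists_norm_eq_iInf_of_complete_convex hne hcl.isComplete hc z
  exact ⟨p, hp, (norm_eq_iInf_iff_real_inner_le_zero hc hp).1 hmin⟩

theorem proj_eq {C : Set E} {z p : E} (hp : p ∈ C)
    (h : ∀ y ∈ C, inner ℝ (z - p) (y - p) ≤ 0) : proj C z = p :=
  (isProx_indicator hp h).prox_eq

omit [InnerProductSpace ℝ E] in
theorem isProx_prox_of_isProx {f : E → EReal} {z p : E} (h : IsProx f z p) :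
    IsProx f z (prox f z) := by
  rwa [h.prox_eq]

end Prox

/-! ### Coordinates -/

@[simp] theorem pt2_fst (x η : ℝ) : (pt2 x η).fst = x := rfl

@[simp] theorem pt2_snd (x η : ℝ) : (pt2 x η).snd = η := rfl

@[simp] theorem pt3_fst (z : WithLp 2 (ℝ × ℝ)) (δ : ℝ) : (pt3 z δ).fst = z := rfl

@[simp] theorem pt3_snd (z : WithLp 2 (ℝ × ℝ)) (δ : ℝ) : (pt3 z δ).snd = δ := rfl

theorem pt2_eta (z : WithLp 2 (ℝ × ℝ)) : pt2 z.fst z.snd = z := rfl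

theorem inner_sub_pt2 (z p y : WithLp 2 (ℝ × ℝ)) :
    inner ℝ (z - p) (y - p) =
      (z.fst - p.fst) * (y.fst - p.fst) + (z.snd - p.snd) * (y.snd - p.snd) := by
  simp only [WithLp.prod_inner_apply, WithLp.sub_fst, WithLp.sub_snd, RCLike.inner_apply,
    conj_trivial, WithLp.ofLp_fst, WithLp.ofLp_snd]
  ring

theorem inner_sub_pt3 (w p y : WithLp 2 (WithLp 2 (ℝ × ℝ) × ℝ)) :
    inner ℝ (w - p) (y - p) =
      inner ℝ (w.fst - p.fst) (y.fst - p.fst) + (w.snd - p.snd) * (y.snd - p.snd) := by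
  simp only [WithLp.prod_inner_apply, WithLp.sub_fst, WithLp.sub_snd, RCLike.inner_apply,
    conj_trivial, WithLp.ofLp_fst, WithLp.ofLp_snd]
  ring

/-! ### The hyperbolic penalty, its recession function and its perspective -/

/-- The hyperbola is the envelope of its tangents. -/
theorem hyperbola_le_iff {η : ℝ} (hη : 0 < η) (x r : ℝ) :
    (x < η ∧ η * x / (η - x) ≤ r) ↔ ∀ s, 0 ≤ s → (x - η) * s ^ 2 + 2 * η * s - η ≤ r := by
  constructor
  · rintro ⟨hx, h⟩ s -
    refine le_trans ?_ h
    have h1 : 0 < η - x := by linarith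
    rw [le_div_iff₀ h1]
    -- After multiplication by `η - x`, the gap between hyperbola and tangent is exactly this
    -- square.
    nlinarith [sq_nonneg ((η - x) * s - η)]
  · intro h
    have hx : x < η := by
      by_contra! hx
      -- If `x ≥ η` the quadratic term is nonnegative, and this `s` makes the rest equal to `2 * |r|
      -- + η > r`.
      have h1 := h ((|r| + η) / η) (by positivity)
      have h2 : 2 * η * ((|r| + η) / η) = 2 * (|r| + η) := by field_simp
      have h3 : 0 ≤ (x - η) * ((|r| + η) / η) ^ 2 := mul_nonneg (by linarith) (sq_nonneg _)
      rw [h2] at h1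
      have := le_abs_self r
      have := abs_nonneg r
      linarith
    refine ⟨hx, ?_⟩
    have h1 : 0 < η - x := by linarith
    -- The parameter of the tangent that touches the hyperbola at `x`.
    convert h (η / (η - x)) (by positivity) using 1
    field_simp
    ring

theorem hyp_of_lt {x : ℝ} (hx : x < 1) : hyp x = ((x / (1 - x) : ℝ) : EReal) := by
  simp [hyp, hx]

theorem hyp_of_le {x : ℝ} (hx : 1 ≤ x) : hyp x = ⊤ := by
  simp [hyp, hx]

theorem hyp_le_iff (x r : ℝ) :
    hyp x ≤ (r : EReal) ↔ ∀ s, 0 ≤ s → (x - 1) * s ^ 2 + 2 * 1 * s - 1 ≤ r := by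
  rw [← hyperbola_le_iff one_pos x r, one_mul]
  rcases lt_or_ge x 1 with hx | hx
  · simp only [hyp_of_lt hx, EReal.coe_le_coe_iff, hx, true_and]
  · simp [hyp_of_le hx, hx.not_gt]

theorem hyp_ne_bot (x : ℝ) : hyp x ≠ ⊥ := by
  unfold hyp; split_ifs <;> simp

theorem mem_dom_hyp {x : ℝ} : x ∈ dom hyp ↔ x < 1 := by
  rcases lt_or_ge x 1 with hx | hx
  · simp [dom, hyp_of_lt hx, hx, EReal.coe_lt_top]
  · simp [dom, hyp_of_le hx, hx]

theorem gamma0_hyp : Gamma0 hyp where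
  ne_bot := hyp_ne_bot
  proper := ⟨0, mem_dom_hyp.2 one_pos⟩
  lsc := by
    rw [lowerSemicontinuous_iff_isClosed_preimage]
    intro y
    induction y with
    | bot =>
      convert isClosed_empty
      ext x
      simp [hyp_ne_bot]
    | top => simp
    | coe r =>
      have : hyp ⁻¹' Set.Iic (r : EReal) =
          ⋂ s : ℝ, ⋂ _ : 0 ≤ s, {x : ℝ | (x - 1) * s ^ 2 + 2 * 1 * s - 1 ≤ r} := by
        ext x
        simp [hyp_le_iff]
      rw [this]
      exact isClosed_iInter fun s => isClosed_iInter fun _ =>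
        isClosed_le (by fun_prop) continuous_const
  convex := by
    intro z hz w hw a b ha hb hab
    simp only [epi, Set.mem_ofPred_eq, hyp_le_iff, WithLp.add_fst, WithLp.add_snd,
      WithLp.smul_fst, WithLp.smul_snd, smul_eq_mul] at hz hw ⊢
    intro s hs
    have h1 := mul_le_mul_of_nonneg_left (hz s hs) ha
    have h2 := mul_le_mul_of_nonneg_left (hw s hs) hb
    obtain rfl : b = 1 - a := by linarith
    linarith

theorem diffQuot_hyp_of_nonpos {x₀ x t : ℝ} (hx₀ : x₀ < 1) (hx : x ≤ 0) (ht : 0 < t) :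
    diffQuot hyp x₀ x t =
      ((((x₀ + t * x) / (1 - (x₀ + t * x)) - x₀ / (1 - x₀)) / t : ℝ) : EReal) := by
  have h : x₀ + t * x < 1 := by nlinarith
  simp only [diffQuot, smul_eq_mul, hyp_of_lt h, hyp_of_lt hx₀]
  norm_cast

theorem tendsto_diffQuot_hyp {x₀ : ℝ} (hx₀ : x₀ < 1) (x : ℝ) :
    Tendsto (diffQuot hyp x₀ x) atTop (𝓝 (indicator (Set.Iic (0 : ℝ)) x)) := by
  rcases le_or_gt x 0 with hx | hx
  · have h0 : indicator (Set.Iic (0 : ℝ)) x = ((0 : ℝ) : EReal) := by simp [indicator, hx]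
    rw [h0]
    have hlim : Tendsto (fun t : ℝ => (1 / (1 - x₀)) / t) atTop (𝓝 0) :=
      tendsto_const_nhds.div_atTop tendsto_id
    have hreal : Tendsto (fun t : ℝ =>
        ((x₀ + t * x) / (1 - (x₀ + t * x)) - x₀ / (1 - x₀)) / t) atTop (𝓝 0) := by
      refine squeeze_zero_norm' ?_ hlim
      filter_upwards [eventually_gt_atTop 0] with t ht
      have h1 : 0 < 1 - x₀ := by linarith
      have h2 : 1 - x₀ ≤ 1 - (x₀ + t * x) := by nlinarith
      have h3 : 0 < 1 - (x₀ + t * x) := by linarith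
      rw [Real.norm_eq_abs, abs_div, abs_of_pos ht]
      refine div_le_div_of_nonneg_right ?_ ht.le
      -- Since `ξ / (1 - ξ) = 1 / (1 - ξ) - 1`, the increment is a difference of two numbers in `]0,
      -- 1 / (1 - x₀)]`, hence bounded in `t`.
      have e1 : (x₀ + t * x) / (1 - (x₀ + t * x)) - x₀ / (1 - x₀) =
          1 / (1 - (x₀ + t * x)) - 1 / (1 - x₀) := by
        field_simp
        ring
      have h4 : 1 / (1 - (x₀ + t * x)) ≤ 1 / (1 - x₀) := one_div_le_one_div_of_le h1 h2
      have h5 : 0 < 1 / (1 - (x₀ + t * x)) := by positivity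
      rw [e1, abs_le]
      constructor <;> linarith
    refine ((continuous_coe_real_ereal.tendsto 0).comp hreal).congr' ?_
    filter_upwards [eventually_gt_atTop 0] with t ht
    exact (diffQuot_hyp_of_nonpos hx₀ hx ht).symm
  · have h0 : indicator (Set.Iic (0 : ℝ)) x = ⊤ := by simp [indicator, hx]
    rw [h0]
    refine tendsto_const_nhds.congr' ?_
    filter_upwards [eventually_gt_atTop 0, eventually_ge_atTop ((1 - x₀) / x)] with t ht ht'
    rw [div_le_iff₀ hx] at ht'
    simp only [diffQuot, smul_eq_mul, hyp_of_lt hx₀]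
    rw [hyp_of_le (by linarith), EReal.top_sub_coe,
      EReal.top_div_of_pos_ne_top (by exact_mod_cast ht) (EReal.coe_ne_top t)]

theorem recession_hyp (x : ℝ) : recession hyp x = indicator (Set.Iic (0 : ℝ)) x := by
  unfold recession
  have : ∀ x₀ ∈ dom hyp, limsup (diffQuot hyp x₀ x) atTop = indicator (Set.Iic (0 : ℝ)) x :=
    fun x₀ hx₀ => (tendsto_diffQuot_hyp (mem_dom_hyp.1 hx₀) x).limsup_eq
  refine (iSup_congr fun x₀ => iSup_congr (this x₀)).trans ?_
  exact biSup_const gamma0_hyp.proper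

theorem hypPersp_of_pos {x η : ℝ} (hη : 0 < η) (hx : x < η) :
    hypPersp (pt2 x η) = ((η * x / (η - x) : ℝ) : EReal) := by
  have h1 : η⁻¹ * x < 1 := by rwa [inv_mul_lt_iff₀ hη, mul_one]
  have h2 : η - x ≠ 0 := by linarith
  simp only [hypPersp, perspective, pt2_fst, pt2_snd, if_pos hη, smul_eq_mul, hyp_of_lt h1,
    ← EReal.coe_mul]
  congr 1
  have h3 : 1 - η⁻¹ * x ≠ 0 := by linarith
  field_simp

theorem hypPersp_zero (x : ℝ) : hypPersp (pt2 x 0) = indicator (Set.Iic (0 : ℝ)) x := by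
  simp [hypPersp, perspective, recession_hyp]

theorem hypPersp_eq_top {x η : ℝ} (h : ¬ (0 < η ∧ x < η)) (hη : η ≠ 0) :
    hypPersp (pt2 x η) = ⊤ := by
  by_cases h0 : 0 < η
  · refine (if_pos h0).trans ?_
    have h1 : 1 ≤ η⁻¹ * x := by
      rw [le_inv_mul_iff₀ h0, mul_one]
      by_contra! h2
      exact h ⟨h0, h2⟩
    simp only [pt2_fst, pt2_snd, smul_eq_mul]
    rw [hyp_of_le h1, EReal.coe_mul_top_of_pos h0]
  · exact (if_neg h0).trans (if_neg hη)

/-- The perspective is the support function of the subgraph of the negated conjugate. -/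
theorem hypPersp_le_iff (x η r : ℝ) :
    hypPersp (pt2 x η) ≤ (r : EReal) ↔
      0 ≤ η ∧ ∀ s, 0 ≤ s → (x - η) * s ^ 2 + 2 * η * s - η ≤ r := by
  rcases lt_trichotomy η 0 with hη | rfl | hη
  · rw [hypPersp_eq_top (fun h => by linarith [h.1]) hη.ne]
    simp [hη.not_ge]
  · rw [hypPersp_zero]
    rcases le_or_gt x 0 with hx | hx
    · have : indicator (Set.Iic (0 : ℝ)) x = ((0 : ℝ) : EReal) := by simp [indicator, hx]
      rw [this, EReal.coe_le_coe_iff]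
      refine ⟨fun h => ⟨le_rfl, fun s _ => by nlinarith [sq_nonneg s]⟩, fun h => ?_⟩
      simpa using h.2 0 le_rfl
    · have : indicator (Set.Iic (0 : ℝ)) x = ⊤ := by simp [indicator, hx]
      rw [this]
      simp only [top_le_iff, EReal.coe_ne_top, false_iff, not_and, not_forall, le_refl,
        true_imp_iff, not_le]
      -- At `η = 0` the form is `x * s ^ 2`, which here is at least `x + 2 * |r| > r`.
      refine ⟨1 + |r| / x, by positivity, ?_⟩
      have h1 : x * (|r| / x) = |r| := by field_simp
      have h2 : 0 ≤ |r| / x := by positivity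
      have := le_abs_self r
      nlinarith [mul_nonneg hx.le h2, mul_nonneg hx.le (sq_nonneg (|r| / x))]
  · rw [← hyperbola_le_iff hη]
    by_cases hx : x < η
    · simp only [hypPersp_of_pos hη hx, EReal.coe_le_coe_iff, hx, hη.le, true_and]
    · rw [hypPersp_eq_top (fun h => hx h.2) hη.ne']
      simp [hx]

theorem hypPersp_ne_bot (z : WithLp 2 (ℝ × ℝ)) : hypPersp z ≠ ⊥ := by
  intro h
  have h1 := ((hypPersp_le_iff z.fst z.snd (-z.snd - 1)).1 (by rw [pt2_eta, h]; exact bot_le)).2 0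
    le_rfl
  linarith

theorem hypPersp_lt_top_iff (x η : ℝ) :
    hypPersp (pt2 x η) < ⊤ ↔ (0 < η ∧ x < η) ∨ (η = 0 ∧ x ≤ 0) := by
  by_cases h : 0 < η ∧ x < η
  · simp [hypPersp_of_pos h.1 h.2, h, EReal.coe_lt_top]
  · by_cases hη : η = 0
    · subst hη
      rw [hypPersp_zero]
      by_cases hx : x ≤ 0 <;> simp [indicator, hx]
    · simp [hypPersp_eq_top h hη, hη, h]

theorem closure_dom_hypPersp :
    closure (dom hypPersp) = {z : WithLp 2 (ℝ × ℝ) | 0 ≤ z.snd ∧ z.fst ≤ z.snd} := by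
  apply subset_antisymm
  · refine closure_minimal ?_ ?_
    · intro z hz
      rcases (hypPersp_lt_top_iff z.fst z.snd).1 hz with h | h
      · exact ⟨h.1.le, h.2.le⟩
      · exact ⟨h.1.ge, h.2.trans h.1.ge⟩
    · have h1 : IsClosed {z : WithLp 2 (ℝ × ℝ) | 0 ≤ z.snd} :=
        isClosed_le (by fun_prop) (by fun_prop)
      have h2 : IsClosed {z : WithLp 2 (ℝ × ℝ) | z.fst ≤ z.snd} :=
        isClosed_le (by fun_prop) (by fun_prop)
      exact h1.inter h2
  · intro z hz
    -- Any upward shift of `η` moves a point of the closed cone into the open one.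
    have hlim : Tendsto (fun ε : ℝ => pt2 z.fst (z.snd + ε)) (𝓝[>] 0) (𝓝 z) := by
      have hc : Continuous fun ε : ℝ => pt2 z.fst (z.snd + ε) := by
        unfold pt2
        fun_prop
      have := hc.tendsto 0
      rw [add_zero, pt2_eta] at this
      exact this.mono_left nhdsWithin_le_nhds
    refine mem_closure_of_tendsto hlim ?_
    filter_upwards [self_mem_nhdsWithin] with ε (hε : 0 < ε)
    exact (hypPersp_lt_top_iff _ _).2 (Or.inl ⟨by linarith [hz.1], by linarith [hz.2]⟩)

theorem isClosed_epi_hypPersp : IsClosed (epi hypPersp) := by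
  have : epi hypPersp = {w | 0 ≤ w.fst.snd} ∩ ⋂ s : ℝ, ⋂ _ : 0 ≤ s,
      {w | (w.fst.fst - w.fst.snd) * s ^ 2 + 2 * w.fst.snd * s - w.fst.snd ≤ w.snd} := by
    ext w
    have := hypPersp_le_iff w.fst.fst w.fst.snd w.snd
    rw [pt2_eta] at this
    simp [epi, this]
  rw [this]
  refine IsClosed.inter (isClosed_le ?_ ?_)
    (isClosed_iInter fun s => isClosed_iInter fun _ => isClosed_le ?_ ?_) <;> fun_prop

theorem convex_epi_hypPersp : Convex ℝ (epi hypPersp) := by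
  intro z hz w hw a b ha hb hab
  have key : ∀ w : WithLp 2 (WithLp 2 (ℝ × ℝ) × ℝ), w ∈ epi hypPersp ↔ _ := fun w =>
    hypPersp_le_iff w.fst.fst w.fst.snd w.snd
  rw [key] at hz hw ⊢
  simp only [WithLp.add_fst, WithLp.add_snd, WithLp.smul_fst, WithLp.smul_snd, smul_eq_mul]
  refine ⟨add_nonneg (mul_nonneg ha hz.1) (mul_nonneg hb hw.1), fun s hs => ?_⟩
  have h1 := mul_le_mul_of_nonneg_left (hz.2 s hs) ha
  have h2 := mul_le_mul_of_nonneg_left (hw.2 s hs) hb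
  linarith

/-! ### The conjugate -/

theorem conjugate_hyp_eq (u : ℝ) :
    hypConj u = ⨆ x : ℝ, ((x * u : ℝ) : EReal) - hyp x := by
  simp only [hypConj, conjugate, RCLike.inner_apply, conj_trivial, mul_comm u]

theorem coe_le_hypConj {x : ℝ} (hx : x < 1) (u : ℝ) :
    ((x * u - x / (1 - x) : ℝ) : EReal) ≤ hypConj u := by
  rw [conjugate_hyp_eq]
  refine le_iSup_of_le x ?_
  rw [hyp_of_lt hx, EReal.coe_sub]

theorem hypConj_of_nonneg {ξ : ℝ} (hξ : 0 ≤ ξ) :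
    hypConj ξ = (((√ξ - 1) ^ 2 : ℝ) : EReal) := by
  apply le_antisymm
  · rw [conjugate_hyp_eq]
    refine iSup_le fun x => ?_
    rcases lt_or_ge x 1 with hx | hx
    · have h := (hyp_le_iff x (x / (1 - x))).1 (hyp_of_lt hx).le √ξ (Real.sqrt_nonneg ξ)
      rw [hyp_of_lt hx, ← EReal.coe_sub, EReal.coe_le_coe_iff]
      rw [Real.sq_sqrt hξ] at h
      have := Real.sq_sqrt hξ
      linarith
    · rw [hyp_of_le hx, EReal.sub_top]
      exact bot_le
  -- The supremum is attained at `1 - 1 / √ξ` if `ξ > 0`; at `ξ = 0` it is only approached, along `x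
  -- = -n`.
  · rcases hξ.eq_or_lt with rfl | hpos
    · have hlim : Tendsto (fun n : ℕ => (((n : ℝ) / (n + 1) : ℝ) : EReal)) atTop
          (𝓝 ((1 : ℝ) : EReal)) :=
        (continuous_coe_real_ereal.tendsto 1).comp (tendsto_natCast_div_add_atTop (1 : ℝ))
      have h1 : (√(0 : ℝ) - 1) ^ 2 = 1 := by simp
      rw [h1]
      refine le_of_tendsto' hlim fun n => ?_
      have hn : (-(n : ℝ)) < 1 := by
        have : (0 : ℝ) ≤ n := n.cast_nonneg
        linarith
      convert coe_le_hypConj hn 0 using 2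
      rw [mul_zero, sub_neg_eq_add, add_comm (1 : ℝ)]
      ring
    · have hs : 0 < √ξ := Real.sqrt_pos.2 hpos
      have hx : 1 - 1 / √ξ < 1 := by
        have : 0 < 1 / √ξ := by positivity
        linarith
      convert coe_le_hypConj hx ξ using 2
      obtain ⟨s, hs', rfl⟩ : ∃ s, 0 < s ∧ s ^ 2 = ξ := ⟨√ξ, hs, Real.sq_sqrt hξ⟩
      rw [Real.sqrt_sq hs'.le]
      field_simp
      ring

theorem hypConj_of_neg {ξ : ℝ} (hξ : ξ < 0) : hypConj ξ = ⊤ := by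
  rw [EReal.eq_top_iff_forall_lt]
  intro r
  set M := (|r| + 1) / (-ξ) with hM
  have hM0 : 0 ≤ M := div_nonneg (by positivity) (by linarith)
  have hMξ : -M * ξ = |r| + 1 := by
    have : ξ ≠ 0 := hξ.ne
    rw [hM]
    field_simp
  refine lt_of_lt_of_le ?_ (coe_le_hypConj (x := -M) (by linarith) ξ)
  rw [EReal.coe_lt_coe_iff, hMξ, neg_div]
  have : 0 ≤ M / (1 - -M) := div_nonneg hM0 (by linarith)
  have := le_abs_self r
  linarith

theorem hypConj_le_iff (ξ r : ℝ) : hypConj ξ ≤ (r : EReal) ↔ 0 ≤ ξ ∧ (√ξ - 1) ^ 2 ≤ r := by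
  rcases lt_or_ge ξ 0 with h | h
  · simp [hypConj_of_neg h, h.not_ge]
  · simp only [hypConj_of_nonneg h, EReal.coe_le_coe_iff, h, true_and]

theorem hypConj_ne_bot (ξ : ℝ) : hypConj ξ ≠ ⊥ := by
  rcases lt_or_ge ξ 0 with h | h
  · simp [hypConj_of_neg h]
  · rw [hypConj_of_nonneg h]; exact EReal.coe_ne_bot _

theorem hypConj_sq {s : ℝ} (hs : 0 ≤ s) : hypConj (s ^ 2) = (((s - 1) ^ 2 : ℝ) : EReal) := by
  rw [hypConj_of_nonneg (sq_nonneg s), Real.sqrt_sq hs]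

theorem dom_hypConj : dom hypConj = Set.Ici (0 : ℝ) := by
  ext ξ
  rcases lt_or_ge ξ 0 with h | h
  · simp [dom, hypConj_of_neg h, h]
  · simp only [dom, Set.mem_ofPred_eq, hypConj_of_nonneg h, EReal.coe_lt_top, Set.mem_Ici, h]

theorem closure_dom_hypConj : closure (dom hypConj) = Set.Ici (0 : ℝ) := by
  rw [dom_hypConj, isClosed_Ici.closure_eq]

theorem variational_Ici (ξ : ℝ) (y : ℝ) (hy : y ∈ Set.Ici (0 : ℝ)) :
    inner ℝ (ξ - max 0 ξ) (y - max 0 ξ) ≤ 0 := by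
  simp only [RCLike.inner_apply, conj_trivial]
  rw [Set.mem_Ici] at hy
  rcases le_total 0 ξ with h | h
  · simp [max_eq_right h]
  · rw [max_eq_left h]
    nlinarith

theorem proj_Ici (ξ : ℝ) : proj (Set.Ici (0 : ℝ)) ξ = max 0 ξ :=
  proj_eq (Set.mem_Ici.2 (le_max_left _ _)) (variational_Ici ξ)

theorem isProx_proj_Ici (ξ : ℝ) :
    IsProx (indicator (Set.Ici (0 : ℝ))) ξ (proj (Set.Ici (0 : ℝ)) ξ) :=
  isProx_prox_of_isProx (isProx_indicator (Set.mem_Ici.2 (le_max_left _ _)) (variational_Ici ξ))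

/-! ### Proximity operators of multiples of the penalty and of its conjugate -/

theorem isProx_scale_hyp {γ x p : ℝ} (hγ : 0 < γ) (hp : p < 1)
    (h : (x - p) * (1 - p) ^ 2 = γ) : IsProx (scale γ hyp) x p := by
  refine isProx_scale_of_subgradient (hyp_of_lt hp) hγ (fun y r hy => ?_) hyp_ne_bot
  have h1 : 0 < 1 - p := by linarith
  -- The tangent at `p` has slope `1 / (1 - p) ^ 2`, hence parameter `1 / (1 - p)`.
  have h2 := mul_le_mul_of_nonneg_left ((hyp_le_iff y r).1 hy (1 / (1 - p)) (by positivity)) hγ.le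
  refine le_trans (le_of_eq ?_) h2
  simp only [RCLike.inner_apply, conj_trivial]
  rw [← h]
  field_simp
  ring

theorem exists_prox_hyp_eq {γ : ℝ} (hγ : 0 < γ) (x : ℝ) :
    ∃ p, p < 1 ∧ (x - p) * (1 - p) ^ 2 = γ := by
  have hc : ContinuousOn (fun p : ℝ => (x - p) * (1 - p) ^ 2) (Set.Icc (min x 1 - 1 - γ) (min x 1)) :=
    by fun_prop
  have hx := min_le_left x 1
  have h1 := min_le_right x 1
  have h0 : (x - min x 1) * (1 - min x 1) ^ 2 = 0 := by
    rcases min_choice x 1 with h | h <;> simp [h]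
  have hbig : γ ≤ (x - (min x 1 - 1 - γ)) * (1 - (min x 1 - 1 - γ)) ^ 2 := by
    have e1 : 1 + γ ≤ x - (min x 1 - 1 - γ) := by linarith
    have e2 : 1 + γ ≤ 1 - (min x 1 - 1 - γ) := by linarith
    have e3 : 1 ≤ (1 - (min x 1 - 1 - γ)) ^ 2 := by nlinarith
    nlinarith
  obtain ⟨p, hp, hpe⟩ := intermediate_value_Icc' (by linarith) hc ⟨h0.trans_le hγ.le, hbig⟩
  refine ⟨p, lt_of_le_of_ne (hp.2.trans h1) ?_, hpe⟩
  rintro rfl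
  simp at hpe
  exact hγ.ne hpe

theorem prox_scale_hyp_spec {γ : ℝ} (hγ : 0 < γ) (x : ℝ) :
    IsProx (scale γ hyp) x (prox (scale γ hyp) x) ∧
      prox (scale γ hyp) x < 1 ∧
      (x - prox (scale γ hyp) x) * (1 - prox (scale γ hyp) x) ^ 2 - γ = 0 ∧
      (∀ p : ℝ, p < 1 → (x - p) * (1 - p) ^ 2 - γ = 0 → p = prox (scale γ hyp) x) := by
  obtain ⟨p, hp, h⟩ := exists_prox_hyp_eq hγ x
  have hprox := isProx_scale_hyp hγ hp h
  refine ⟨isProx_prox_of_isProx hprox, ?_, ?_, fun q hq hqe => ?_⟩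
  · rwa [hprox.prox_eq]
  · rw [hprox.prox_eq, h, sub_self]
  · exact (isProx_scale_hyp hγ hq (sub_eq_zero.1 hqe)).prox_eq.symm

/-- At `s ^ 2` the conjugate has derivative `1 - 1 / s`, so the hypothesis is the optimality
condition `x - s ^ 2 = γ * (1 - 1 / s)`. With `y = t ^ 2`, the gap in the subgradient inequality is
`γ * (t - s) ^ 2 / s`. -/
theorem isProx_scale_hypConj {γ x s : ℝ} (hγ : 0 < γ) (hs : 0 < s)
    (h : s * (s ^ 2 - x + γ) = γ) : IsProx (scale γ hypConj) x (s ^ 2) := by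
  refine isProx_scale_of_subgradient (hypConj_sq hs.le) hγ (fun y r hy => ?_) hypConj_ne_bot
  obtain ⟨hy0, hr⟩ := (hypConj_le_iff y r).1 hy
  refine le_trans ?_ (mul_le_mul_of_nonneg_left hr hγ.le)
  obtain ⟨t, ht, rfl⟩ : ∃ t, 0 ≤ t ∧ t ^ 2 = y := ⟨√y, Real.sqrt_nonneg y, Real.sq_sqrt hy0⟩
  simp only [RCLike.inner_apply, conj_trivial, Real.sqrt_sq ht]
  have hx : x - s ^ 2 = γ * (1 - 1 / s) := by
    field_simp
    linarith
  have key : γ * (t - 1) ^ 2 - (γ * (s - 1) ^ 2 + (t ^ 2 - s ^ 2) * (x - s ^ 2)) =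
      γ * ((t - s) ^ 2 / s) := by
    rw [hx]
    field_simp
    ring
  have : 0 ≤ γ * ((t - s) ^ 2 / s) := by positivity
  linarith

theorem exists_prox_hypConj_eq {γ : ℝ} (hγ : 0 < γ) (x : ℝ) :
    ∃ s, 0 < s ∧ s * (s ^ 2 - x + γ) = γ := by
  have hc : ContinuousOn (fun s : ℝ => s * (s ^ 2 - x + γ)) (Set.Icc 0 (1 + |x|)) := by fun_prop
  have hx := le_abs_self x
  have hx0 := abs_nonneg x
  have hbig : γ ≤ (1 + |x|) * ((1 + |x|) ^ 2 - x + γ) := by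
    have e1 : γ ≤ (1 + |x|) ^ 2 - x + γ := by nlinarith
    nlinarith
  obtain ⟨s, hs, hse⟩ := intermediate_value_Icc (by linarith) hc ⟨by simpa using hγ.le, hbig⟩
  refine ⟨s, lt_of_le_of_ne hs.1 ?_, hse⟩
  rintro rfl
  simp at hse
  exact hγ.ne hse

theorem prox_scale_hypConj_spec {γ : ℝ} (hγ : 0 < γ) (x : ℝ) :
    IsProx (scale γ hypConj) x (prox (scale γ hypConj) x) ∧
      max (x - γ) 0 < prox (scale γ hypConj) x ∧
      prox (scale γ hypConj) x ^ 3 + 2 * (γ - x) * prox (scale γ hypConj) x ^ 2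
        + prox (scale γ hypConj) x * (γ - x) ^ 2 - γ ^ 2 = 0 ∧
      (∀ q : ℝ, max (x - γ) 0 < q →
        q ^ 3 + 2 * (γ - x) * q ^ 2 + q * (γ - x) ^ 2 - γ ^ 2 = 0 →
        q = prox (scale γ hypConj) x) := by
  obtain ⟨s, hs, h⟩ := exists_prox_hypConj_eq hγ x
  have hprox := isProx_scale_hypConj hγ hs h
  refine ⟨isProx_prox_of_isProx hprox, ?_, ?_, fun q hq hqe => ?_⟩
  · rw [hprox.prox_eq]
    refine max_lt ?_ (by positivity)
    have := pos_of_mul_pos_right (h.symm ▸ hγ) hs.le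
    linarith
  · rw [hprox.prox_eq]
    linear_combination (s * (s ^ 2 - x + γ) + γ) * h
  · obtain ⟨hq1, hq0⟩ := max_lt_iff.1 hq
    obtain ⟨t, ht, rfl⟩ : ∃ t, 0 < t ∧ t ^ 2 = q :=
      ⟨√q, Real.sqrt_pos.2 hq0, Real.sq_sqrt hq0.le⟩
    have hpos : 0 < t * (t ^ 2 - x + γ) := mul_pos ht (by linarith)
    -- The cubic in `q = t ^ 2` is a difference of squares; `q > x - γ` excludes the second factor.
    have hfac : (t * (t ^ 2 - x + γ) - γ) * (t * (t ^ 2 - x + γ) + γ) = 0 := by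
      linear_combination hqe
    rcases mul_eq_zero.1 hfac with h1 | h1
    · exact (isProx_scale_hypConj hγ ht (sub_eq_zero.1 h1)).prox_eq.symm
    · linarith

/-! ### Proximity operators of multiples of the perspective -/

/-- `a` is the value of the perspective at `p`, and `z - p` is a subgradient of its multiple by `μ`
there. -/
structure IsPerspProx (μ : ℝ) (z p : WithLp 2 (ℝ × ℝ)) (a : ℝ) : Prop where
  value : hypPersp p = a
  le : ∀ y (r : ℝ), hypPersp y ≤ r → μ * a + inner ℝ (z - p) (y - p) ≤ μ * r

theorem IsPerspProx.isProx {μ : ℝ} {z p : WithLp 2 (ℝ × ℝ)} {a : ℝ} (h : IsPerspProx μ z p a)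
    (hμ : 0 < μ) : IsProx (scale μ hypPersp) z p :=
  isProx_scale_of_subgradient h.value hμ h.le hypPersp_ne_bot

theorem hypPersp_zero_of_nonpos {x : ℝ} (hx : x ≤ 0) : hypPersp (pt2 x 0) = ((0 : ℝ) : EReal) := by
  simp [hypPersp_zero, indicator, hx]

theorem isPerspProx_of_nonpos {μ x η : ℝ} (hμ : 0 < μ)
    (h : η + (√(max 0 x) - √μ) ^ 2 ≤ 0) :
    IsPerspProx μ (pt2 x η) (pt2 (min 0 x) 0) 0 where
  value := hypPersp_zero_of_nonpos (min_le_left _ _)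
  le := by
    intro y r hy
    obtain ⟨hy0, hr⟩ := (hypPersp_le_iff y.fst y.snd r).1 hy
    rw [inner_sub_pt2]
    simp only [pt2_fst, pt2_snd]
    have hμ' := Real.sq_sqrt hμ.le
    have hμ0 : 0 < √μ := Real.sqrt_pos.2 hμ
    have h1 := mul_le_mul_of_nonneg_right h hy0
    rcases le_total x 0 with hx | hx
    · rw [max_eq_left hx, Real.sqrt_zero] at h1
      rw [min_eq_right hx]
      have h2 := mul_le_mul_of_nonneg_left (hr 0 le_rfl) hμ.le
      nlinarith
    · rw [max_eq_right hx] at h1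
      rw [min_eq_left hx]
      have hx' := Real.sq_sqrt hx
      -- The slope `s ^ 2` must equal `x / μ`, as `z - p = (x, η)`; for `x ≤ 0` above, `s = 0`
      -- served.
      have h2 := mul_le_mul_of_nonneg_left (hr (√x / √μ) (by positivity)) hμ.le
      have e1 : μ * ((y.fst - y.snd) * (√x / √μ) ^ 2 + 2 * y.snd * (√x / √μ) - y.snd) =
          y.fst * x - y.snd * (√x - √μ) ^ 2 := by
        obtain ⟨m, hm, rfl⟩ : ∃ m, 0 < m ∧ m ^ 2 = μ := ⟨√μ, hμ0, hμ'⟩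
        obtain ⟨t, ht, rfl⟩ : ∃ t, 0 ≤ t ∧ t ^ 2 = x := ⟨√x, Real.sqrt_nonneg x, hx'⟩
        rw [Real.sqrt_sq hm.le, Real.sqrt_sq ht]
        field_simp
        ring
      linarith

/-- By `h1`, `z - p` is `μ` times the gradient `(s ^ 2, -(s - 1) ^ 2)` of the linear form of
parameter `s`; by `h2`, `p` lies on the ray where that form touches the perspective. -/
theorem isPerspProx_of_pos {μ x η s ν : ℝ} (hμ : 0 < μ) (hs : 0 < s) (hν : 0 < ν)
    (h1 : ν = η + μ * (s - 1) ^ 2) (h2 : s * (s ^ 2 - x / μ + ν / μ) = ν / μ) :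
    IsPerspProx μ (pt2 x η) (pt2 (x - μ * s ^ 2) ν) (ν * (s - 1)) := by
  have h3 : x - μ * s ^ 2 = ν * (1 - 1 / s) := by
    field_simp at h2 ⊢
    linarith
  have hlt : x - μ * s ^ 2 < ν := by
    have : 0 < ν * (1 / s) := by positivity
    rw [h3]
    linarith
  constructor
  · rw [hypPersp_of_pos hν hlt]
    congr 1
    have : ν - (x - μ * s ^ 2) ≠ 0 := by linarith
    rw [h3] at this ⊢
    field_simp
    ring
  · intro y r hy
    obtain ⟨hy0, hr⟩ := (hypPersp_le_iff y.fst y.snd r).1 hy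
    rw [inner_sub_pt2]
    simp only [pt2_fst, pt2_snd]
    have h4 := mul_le_mul_of_nonneg_left (hr s hs.le) hμ.le
    have h5 : s ^ 2 * (x - μ * s ^ 2) = ν * (s - 1) * s := by
      rw [h3]
      field_simp
    have h6 : η - ν = -(μ * (s - 1) ^ 2) := by linarith
    rw [h6]
    have h7 : μ * (ν * (s - 1)) + ((x - (x - μ * s ^ 2)) * (y.fst - (x - μ * s ^ 2)) +
        -(μ * (s - 1) ^ 2) * (y.snd - ν)) =
        μ * ((y.fst - y.snd) * s ^ 2 + 2 * y.snd * s - y.snd) := by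
      linear_combination (-μ) * h5
    exact h7.trans_le h4

theorem exists_perspProx_eq {μ x η : ℝ} (hμ : 0 < μ) (h : 0 < η + (√(max 0 x) - √μ) ^ 2) :
    ∃ s ν, 0 < s ∧ 0 < ν ∧ ν ≤ η + (√(max 0 x) - √μ) ^ 2 ∧ ν = η + μ * (s - 1) ^ 2 ∧
      s * (s ^ 2 - x / μ + ν / μ) = ν / μ := by
  set s₀ := √(max 0 x) / √μ with hs₀
  have hμ' := Real.sq_sqrt hμ.le
  have hμ0 : 0 < √μ := Real.sqrt_pos.2 hμ
  have hs₀0 : 0 ≤ s₀ := by positivity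
  have hmax := Real.sq_sqrt (le_max_left 0 x)
  have hs₀x : μ * s₀ ^ 2 = max 0 x := by
    rw [hs₀, div_pow, hmax, hμ']
    field_simp
  have hβ : (√(max 0 x) - √μ) ^ 2 = μ * (s₀ - 1) ^ 2 := by
    have : √(max 0 x) = √μ * s₀ := by
      rw [hs₀]
      field_simp
    rw [this]
    linear_combination (s₀ - 1) ^ 2 * hμ'
  rw [hβ] at h ⊢
  set β := η + μ * (s₀ - 1) ^ 2 with hβdef
  have hxs : s₀ * x = s₀ * (μ * s₀ ^ 2) := by
    rw [hs₀x]
    rcases le_total x 0 with hx | hx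
    · have : s₀ = 0 := by simp [hs₀, max_eq_left hx]
      simp [this]
    · rw [max_eq_right hx]
  have hxle : x ≤ μ * s₀ ^ 2 := hs₀x ▸ le_max_right 0 x
  -- The second equation times `μ`, after eliminating `ν`. A root between `s₀` and `1` has `|s - 1|
  -- ≤ |s₀ - 1|`, which gives `ν ≤ β`.
  let G : ℝ → ℝ := fun s => μ * s ^ 3 + (s - 1) * (η + μ * (s - 1) ^ 2) - s * x
  have hG : Continuous G := by fun_prop
  have hG₀ : G s₀ = (s₀ - 1) * β := by
    simp only [G, hβdef]
    linear_combination -hxs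
  have hG1 : G 1 = μ - x := by simp [G]
  -- it suffices to find a root between `s₀` and `1`
  suffices hroot : ∃ s, 0 < s ∧ G s = 0 ∧ (s - 1) ^ 2 ≤ (s₀ - 1) ^ 2 ∧ 0 < η + μ * (s - 1) ^ 2 by
    obtain ⟨s, hs, hGs, hle, hpos⟩ := hroot
    refine ⟨s, η + μ * (s - 1) ^ 2, hs, hpos, ?_, rfl, ?_⟩
    · have := mul_le_mul_of_nonneg_left hle hμ.le
      linarith
    · simp only [G] at hGs
      field_simp
      linarith
  rcases lt_trichotomy s₀ 1 with hlt | heq | hgt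
  · have hx1 : x < μ := by nlinarith
    obtain ⟨s, hs, hGs⟩ := intermediate_value_Ioo hlt.le hG.continuousOn
      (show (0 : ℝ) ∈ Set.Ioo (G s₀) (G 1) from
        ⟨by rw [hG₀]; nlinarith, by rw [hG1]; linarith⟩)
    refine ⟨s, hs₀0.trans_lt hs.1, hGs, by nlinarith [hs.1, hs.2], ?_⟩
    have hsx : x < μ * s ^ 2 := by
      have : s₀ ^ 2 < s ^ 2 := by nlinarith [hs.1]
      nlinarith
    -- If `ν ≤ 0`, both `(s - 1) * ν ≥ 0` and `s * (μ * s ^ 2 - x) > 0`, so `G s > 0`.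
    by_contra! hneg
    have h1 : 0 ≤ (s - 1) * (η + μ * (s - 1) ^ 2) :=
      mul_nonneg_of_nonpos_of_nonpos (by linarith [hs.2]) hneg
    have h2 : 0 < s * (μ * s ^ 2 - x) := mul_pos (hs₀0.trans_lt hs.1) (by linarith)
    simp only [G] at hGs
    linarith
  · refine ⟨s₀, by linarith, by rw [hG₀, heq]; ring, le_rfl, h⟩
  · have hx0 : x = μ * s₀ ^ 2 := (mul_left_cancel₀ (by linarith) hxs)
    have hx1 : μ < x := by nlinarith
    obtain ⟨s, hs, hGs⟩ := intermediate_value_Ioo hgt.le hG.continuousOn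
      (show (0 : ℝ) ∈ Set.Ioo (G 1) (G s₀) from
        ⟨by rw [hG1]; linarith, by rw [hG₀]; exact mul_pos (by linarith) h⟩)
    have hs0 : 0 < s := by linarith [hs.1]
    refine ⟨s, hs0, hGs, by nlinarith [hs.1, hs.2], ?_⟩
    have hsx : μ * s ^ 2 < x := by
      have : s ^ 2 < s₀ ^ 2 := by nlinarith [hs.2]
      nlinarith
    by_contra! hneg
    have h1 : (s - 1) * (η + μ * (s - 1) ^ 2) ≤ 0 :=
      mul_nonpos_of_nonneg_of_nonpos (by linarith [hs.1]) hneg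
    have h2 : s * (μ * s ^ 2 - x) < 0 := mul_neg_of_pos_of_neg hs0 (by linarith)
    simp only [G] at hGs
    linarith

theorem exists_isPerspProx {μ : ℝ} (hμ : 0 < μ) (z : WithLp 2 (ℝ × ℝ)) :
    ∃ p a, IsPerspProx μ z p a := by
  rcases le_or_gt (z.snd + (√(max 0 z.fst) - √μ) ^ 2) 0 with h | h
  · exact ⟨_, _, isPerspProx_of_nonpos hμ h⟩
  · obtain ⟨s, ν, hs, hν, -, h1, h2⟩ := exists_perspProx_eq hμ h
    exact ⟨_, _, isPerspProx_of_pos hμ hs hν h1 h2⟩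

theorem isProx_prox_scale_hypPersp {μ : ℝ} (hμ : 0 < μ) (z : WithLp 2 (ℝ × ℝ)) :
    IsProx (scale μ hypPersp) z (prox (scale μ hypPersp) z) := by
  obtain ⟨p, a, h⟩ := exists_isPerspProx hμ z
  exact isProx_prox_of_isProx (h.isProx hμ)

theorem proj_condition_iff {μ : ℝ} (hμ : 0 < μ) (x η : ℝ) :
    (η : EReal) + (μ : EReal) * hypConj (proj (closure (dom hypConj)) (x / μ)) ≤ 0 ↔
      η + (√(max 0 x) - √μ) ^ 2 ≤ 0 := by
  have hμ' := Real.sq_sqrt hμ.le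
  have hμ0 : 0 < √μ := Real.sqrt_pos.2 hμ
  have hmax : max 0 (x / μ) = max 0 x / μ := by
    rw [← max_div_div_right hμ.le, zero_div]
  rw [closure_dom_hypConj, proj_Ici, hypConj_of_nonneg (le_max_left _ _), hmax,
    Real.sqrt_div (le_max_left _ _), ← EReal.coe_mul, ← EReal.coe_add, EReal.coe_nonpos]
  have : μ * (√(max 0 x) / √μ - 1) ^ 2 = (√(max 0 x) - √μ) ^ 2 := by
    nth_rewrite 1 [← hμ']
    field_simp
  rw [this]

theorem prox_scale_hypPersp_of_pos {μ : ℝ} (hμ : 0 < μ) {x η : ℝ}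
    (hβ : ¬ η + (√(max 0 x) - √μ) ^ 2 ≤ 0) :
    ∃ ν : ℝ, 0 < ν ∧ ν ≤ η + (√(max 0 x) - √μ) ^ 2 ∧
      (ν : EReal) =
        (η : EReal) + (μ : EReal) * hypConj (prox (scale (ν / μ) hypConj) (x / μ)) ∧
      ν = η + μ * (√(prox (scale (ν / μ) hypConj) (x / μ)) - 1) ^ 2 ∧
      (∀ ν' : ℝ, 0 < ν' →
        (ν' : EReal) =
          (η : EReal) + (μ : EReal) * hypConj (prox (scale (ν' / μ) hypConj) (x / μ)) →
        ν' = ν) ∧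
      (∀ ν' : ℝ, 0 < ν' →
        ν' = η + μ * (√(prox (scale (ν' / μ) hypConj) (x / μ)) - 1) ^ 2 → ν' = ν) ∧
      prox (scale μ hypPersp) (pt2 x η) =
        pt2 (x - μ * prox (scale (ν / μ) hypConj) (x / μ)) ν ∧
      hypPersp (prox (scale μ hypPersp) (pt2 x η)) =
        ((ν * (prox (scale (μ / ν) hyp) (x / ν) / (1 - prox (scale (μ / ν) hyp) (x / ν))) : ℝ) :
          EReal) := by
  obtain ⟨s, ν, hs, hν, hνβ, h1, h2⟩ := exists_perspProx_eq hμ (not_le.1 hβ)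
  have hpp := isPerspProx_of_pos hμ hs hν h1 h2
  have hprox := (hpp.isProx hμ).prox_eq
  have hq : prox (scale (ν / μ) hypConj) (x / μ) = s ^ 2 :=
    (isProx_scale_hypConj (by positivity) hs h2).prox_eq
  have huniq : ∀ ν' : ℝ, 0 < ν' →
      ν' = η + μ * (√(prox (scale (ν' / μ) hypConj) (x / μ)) - 1) ^ 2 → ν' = ν := by
    -- Any solution `ν'` is the second coordinate of the same proximal point.
    intro ν' hν' h
    obtain ⟨t, ht, h2'⟩ := exists_prox_hypConj_eq (γ := ν' / μ) (by positivity) (x / μ)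
    rw [(isProx_scale_hypConj (by positivity) ht h2').prox_eq, Real.sqrt_sq ht.le] at h
    have := ((isPerspProx_of_pos hμ ht hν' h h2').isProx hμ).prox_eq
    rw [hprox] at this
    exact (congrArg (fun z => z.snd) this).symm
  refine ⟨ν, hν, hνβ, ?_, ?_, fun ν' hν' h => huniq ν' hν' ?_, huniq, ?_, ?_⟩
  · rw [hq, hypConj_sq hs.le, ← EReal.coe_mul, ← EReal.coe_add, ← h1]
  · rw [hq, Real.sqrt_sq hs.le, ← h1]
  · have hq0 := (prox_scale_hypConj_spec (γ := ν' / μ) (by positivity) (x / μ)).2.1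
    rw [hypConj_of_nonneg ((le_max_right _ _).trans hq0.le)] at h
    exact_mod_cast h
  · rw [hprox, hq]
  · have hp : prox (scale (μ / ν) hyp) (x / ν) = 1 - 1 / s := by
      refine (isProx_scale_hyp (by positivity) ?_ ?_).prox_eq
      · have : 0 < 1 / s := by positivity
        linarith
      · field_simp at h2 ⊢
        linear_combination -h2
    rw [hprox, hpp.value, hp]
    congr 1
    field_simp
    ring

/-! ### The projection onto the closed domain of the perspective -/

theorem mem_closure_dom_hypPersp {z : WithLp 2 (ℝ × ℝ)} :
    z ∈ closure (dom hypPersp) ↔ 0 ≤ z.snd ∧ z.fst ≤ z.snd := by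
  rw [closure_dom_hypPersp]
  rfl

theorem proj_dom_eq {z p : WithLp 2 (ℝ × ℝ)} (hp : 0 ≤ p.snd ∧ p.fst ≤ p.snd)
    (h : ∀ a b : ℝ, 0 ≤ b → a ≤ b →
      (z.fst - p.fst) * (a - p.fst) + (z.snd - p.snd) * (b - p.snd) ≤ 0) :
    proj (closure (dom hypPersp)) z = p := by
  refine proj_eq (mem_closure_dom_hypPersp.2 hp) fun y hy => ?_
  rw [inner_sub_pt2]
  obtain ⟨h1, h2⟩ := mem_closure_dom_hypPersp.1 hy
  exact h _ _ h1 h2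

theorem proj_dom_of_polar {x η : ℝ} (hη : η ≤ 0) (hx : x ≤ -η) :
    proj (closure (dom hypPersp)) (pt2 x η) = pt2 (min 0 x) 0 := by
  refine proj_dom_eq ⟨le_rfl, min_le_left _ _⟩ fun a b hb hab => ?_
  simp only [pt2_fst, pt2_snd]
  rcases le_total 0 x with h | h
  · rw [min_eq_left h]
    nlinarith
  · rw [min_eq_right h]
    nlinarith

theorem proj_dom_of_abs_le {x η : ℝ} (h : |η| ≤ x) :
    proj (closure (dom hypPersp)) (pt2 x η) = pt2 ((x + η) / 2) ((x + η) / 2) := by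
  obtain ⟨h1, h2⟩ := abs_le.1 h
  refine proj_dom_eq ⟨by simp only [pt2_snd]; linarith, le_rfl⟩ fun a b hb hab => ?_
  simp only [pt2_fst, pt2_snd]
  nlinarith

theorem proj_dom_of_mem {x η : ℝ} (hη : 0 ≤ η) (hx : x ≤ η) :
    proj (closure (dom hypPersp)) (pt2 x η) = pt2 x η :=
  proj_dom_eq ⟨hη, hx⟩ fun a b _ _ => by simp

theorem mem_of_not_polar {x η : ℝ} (h1 : ¬ (η ≤ 0 ∧ x ≤ -η)) (h2 : ¬ |η| ≤ x) :
    0 ≤ η ∧ x ≤ η := by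
  rw [abs_le] at h2
  by_cases hη : 0 ≤ η
  · refine ⟨hη, ?_⟩
    by_contra! h
    exact h2 ⟨by linarith, h.le⟩
  · exfalso
    have h3 : -η < x := by
      by_contra! h
      exact h1 ⟨by linarith, h⟩
    exact h2 ⟨by linarith, by linarith⟩

theorem exists_proj_dom (z : WithLp 2 (ℝ × ℝ)) :
    ∃ p ∈ closure (dom hypPersp), ∀ y ∈ closure (dom hypPersp), inner ℝ (z - p) (y - p) ≤ 0 := by
  have hconv : Convex ℝ (closure (dom hypPersp)) := by
    intro y hy w hw a b ha hb _
    rw [mem_closure_dom_hypPersp] at hy hw ⊢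
    simp only [WithLp.add_fst, WithLp.add_snd, WithLp.smul_fst, WithLp.smul_snd, smul_eq_mul]
    exact ⟨add_nonneg (mul_nonneg ha hy.1) (mul_nonneg hb hw.1),
      add_le_add (mul_le_mul_of_nonneg_left hy.2 ha) (mul_le_mul_of_nonneg_left hw.2 hb)⟩
  exact exists_variational_projection
    ⟨pt2 0 0, mem_closure_dom_hypPersp.2 ⟨le_rfl, le_rfl⟩⟩ isClosed_closure hconv z

theorem isProx_proj_dom (z : WithLp 2 (ℝ × ℝ)) :
    IsProx (indicator (closure (dom hypPersp))) z (proj (closure (dom hypPersp)) z) := by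
  obtain ⟨p, hp, h⟩ := exists_proj_dom z
  exact isProx_prox_of_isProx (isProx_indicator hp h)

theorem hypPersp_of_mem {x η : ℝ} (hη : 0 ≤ η) (hx : x < η) :
    hypPersp (pt2 x η) = ((η * x / (η - x) : ℝ) : EReal) := by
  rcases hη.eq_or_lt with rfl | hη
  · rw [hypPersp_zero_of_nonpos hx.le, zero_mul, zero_div]
  · exact hypPersp_of_pos hη hx

theorem hypPersp_proj_of_polar {x η : ℝ} (hη : η ≤ 0) (hx : x ≤ -η) :
    hypPersp (proj (closure (dom hypPersp)) (pt2 x η)) = 0 := by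
  rw [proj_dom_of_polar hη hx, hypPersp_zero_of_nonpos (min_le_left _ _)]
  rfl

theorem hypPersp_proj_of_mem {x η : ℝ} (hη : 0 ≤ η) (hx : x < η) :
    hypPersp (proj (closure (dom hypPersp)) (pt2 x η)) =
      ((η * x / (η - x) : ℝ) : EReal) := by
  rw [proj_dom_of_mem hη hx.le, hypPersp_of_mem hη hx]

theorem hypPersp_proj_eq_top {x η : ℝ} (h1 : ¬ (η ≤ 0 ∧ x ≤ -η)) (h2 : ¬ (0 ≤ η ∧ x < η)) :
    hypPersp (proj (closure (dom hypPersp)) (pt2 x η)) = ⊤ := by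
  have h3 : |η| ≤ x := by
    by_contra h3
    obtain ⟨h4, h5⟩ := mem_of_not_polar h1 h3
    have h6 : x = η := le_antisymm h5 (not_lt.1 fun h => h2 ⟨h4, h⟩)
    exact h3 (by rw [abs_of_nonneg h4, h6])
  have h4 : 0 < x + η := by
    have := neg_abs_le η
    refine lt_of_le_of_ne (by linarith) fun h => h1 ⟨?_, by linarith⟩
    have := abs_nonneg η
    linarith
  rw [proj_dom_of_abs_le h3]
  exact hypPersp_eq_top (fun h => lt_irrefl _ h.2) (by positivity)

theorem hypPersp_proj_le_iff (x η δ : ℝ) :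
    hypPersp (proj (closure (dom hypPersp)) (pt2 x η)) ≤ (δ : EReal) ↔
      (0 ≤ η ∧ x < η ∧ η * x / (η - x) ≤ δ) ∨ (η ≤ 0 ∧ x ≤ -η ∧ 0 ≤ δ) := by
  by_cases h1 : η ≤ 0 ∧ x ≤ -η
  · rw [hypPersp_proj_of_polar h1.1 h1.2, EReal.coe_nonneg]
    refine ⟨fun h => Or.inr ⟨h1.1, h1.2, h⟩, ?_⟩
    rintro (⟨h2, -, h3⟩ | h)
    · have : η = 0 := le_antisymm h1.1 h2
      simpa [this] using h3
    · exact h.2.2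
  · by_cases h2 : 0 ≤ η ∧ x < η
    · rw [hypPersp_proj_of_mem h2.1 h2.2, EReal.coe_le_coe_iff]
      refine ⟨fun h => Or.inl ⟨h2.1, h2.2, h⟩, ?_⟩
      rintro (h | h)
      · exact h.2.2
      · exact absurd ⟨h.1, h.2.1⟩ h1
    · rw [hypPersp_proj_eq_top h1 h2]
      refine ⟨fun h => absurd (top_le_iff.1 h) (EReal.coe_ne_top δ), ?_⟩
      rintro (h | h)
      · exact absurd ⟨h.1, h.2.1⟩ h2
      · exact absurd ⟨h.1, h.2.1⟩ h1

/-! ### The projection onto the hyperbolic cone -/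

theorem exists_proj_epi (w : WithLp 2 (WithLp 2 (ℝ × ℝ) × ℝ)) :
    ∃ p ∈ epi hypPersp, ∀ y ∈ epi hypPersp, inner ℝ (w - p) (y - p) ≤ 0 := by
  refine exists_variational_projection ⟨pt3 (pt2 0 0) 0, ?_⟩ isClosed_epi_hypPersp
    convex_epi_hypPersp w
  exact (hypPersp_zero_of_nonpos le_rfl).le

theorem isProx_proj_epi (w : WithLp 2 (WithLp 2 (ℝ × ℝ) × ℝ)) :
    IsProx (indicator (epi hypPersp)) w (proj (epi hypPersp) w) := by
  obtain ⟨p, hp, h⟩ := exists_proj_epi w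
  exact isProx_prox_of_isProx (isProx_indicator hp h)

theorem mem_closure_of_hypPersp_le {z : WithLp 2 (ℝ × ℝ)} {r : ℝ} (h : hypPersp z ≤ r) :
    z ∈ closure (dom hypPersp) :=
  subset_closure (h.trans_lt (EReal.coe_lt_top r))

/-- The epigraph lies in `D × ℝ`, where `D` is the closed domain, and the projection `(P_D z, δ)`
onto this larger set already belongs to it. -/
theorem proj_epi_of_polar {x η δ : ℝ} (hη : η ≤ 0) (hx : x ≤ -η) (hδ : 0 ≤ δ) :
    proj (epi hypPersp) (pt3 (pt2 x η) δ) = pt3 (pt2 (min 0 x) 0) δ := by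
  refine proj_eq ?_ fun y hy => ?_
  · refine (hypPersp_zero_of_nonpos (min_le_left 0 x)).le.trans ?_
    exact_mod_cast hδ
  · obtain ⟨h1, h2⟩ := mem_closure_dom_hypPersp.1 (mem_closure_of_hypPersp_le hy)
    rw [inner_sub_pt3, inner_sub_pt2]
    simp only [pt3_fst, pt3_snd, pt2_fst, pt2_snd]
    rcases le_total 0 x with h | h
    · rw [min_eq_left h]
      nlinarith
    · rw [min_eq_right h]
      nlinarith

theorem proj_epi_of_mem {z : WithLp 2 (ℝ × ℝ)} {δ : ℝ} (h : hypPersp z ≤ δ) :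
    proj (epi hypPersp) (pt3 z δ) = pt3 z δ :=
  proj_eq h fun y _ => by simp

theorem IsPerspProx.proj_epi_eq {μ δ : ℝ} {z p : WithLp 2 (ℝ × ℝ)}
    (h : IsPerspProx μ z p (μ + δ)) : proj (epi hypPersp) (pt3 z δ) = pt3 p (δ + μ) := by
  refine proj_eq ?_ fun y hy => ?_
  · refine h.value.le.trans ?_
    rw [pt3_snd, add_comm]
  · have h1 := h.le y.fst y.snd hy
    rw [inner_sub_pt3]
    simp only [pt3_fst, pt3_snd]
    linarith

/-- Test the subgradient inequality at `y = P_D z`: the projection inequality makes `⟪z - p, y - p⟫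
≥ ‖y - p‖ ^ 2 ≥ 0`. This yields the upper bounds on `μ`. -/
theorem IsPerspProx.value_le {μ a c : ℝ} {z p : WithLp 2 (ℝ × ℝ)} (hμ : 0 < μ)
    (h : IsPerspProx μ z p a) (hc : hypPersp (proj (closure (dom hypPersp)) z) ≤ c) : a ≤ c := by
  obtain ⟨y, hy, hyv⟩ := exists_proj_dom z
  rw [proj_eq hy hyv] at hc
  have h1 := h.le y c hc
  have h2 := hyv p (mem_closure_of_hypPersp_le h.value.le)
  have h3 : inner ℝ (z - p) (y - p) = inner ℝ (y - p) (y - p) - inner ℝ (z - y) (p - y) := by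
    simp only [inner_sub_pt2]
    ring
  have h4 : 0 ≤ inner ℝ (y - p) (y - p) := real_inner_self_nonneg
  exact le_of_mul_le_mul_left (by linarith) hμ

theorem exists_isPerspProx_of_hypPersp_proj {z : WithLp 2 (ℝ × ℝ)} {δ : ℝ}
    (h : ¬ hypPersp (proj (closure (dom hypPersp)) z) ≤ δ) :
    ∃ μ p, 0 < μ ∧ IsPerspProx μ z p (μ + δ) := by
  obtain ⟨p, hp, hv⟩ := exists_proj_epi (pt3 z δ)
  have hv' : ∀ y (r : ℝ), hypPersp y ≤ r →
      inner ℝ (z - p.fst) (y - p.fst) + (δ - p.snd) * (r - p.snd) ≤ 0 := by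
    intro y r hy
    have := hv (pt3 y r) hy
    rwa [inner_sub_pt3] at this
  have hp' : hypPersp p.fst ≤ p.snd := hp
  -- The epigraph contains the vertical ray above each of its points.
  have hge : δ ≤ p.snd := by
    have := hv' p.fst (p.snd + 1) (hp'.trans (by exact_mod_cast (lt_add_one p.snd).le))
    rw [sub_self, inner_zero_right] at this
    linarith
  have hne : δ ≠ p.snd := by
    intro heq
    refine h ?_
    -- With no vertical displacement, the inequality on the domain extends to its closure, so
    -- `p.fst` is `P_D z`, against `h`.
    have hsub : closure (dom hypPersp) ⊆ {y | inner ℝ (z - p.fst) (y - p.fst) ≤ 0} := by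
      refine closure_minimal (fun y hy => ?_) (isClosed_le (by fun_prop) continuous_const)
      have := hv' y (hypPersp y).toReal (EReal.le_coe_toReal (ne_of_lt hy))
      rwa [heq, sub_self, zero_mul, add_zero] at this
    rw [proj_eq (mem_closure_of_hypPersp_le hp') fun y hy => hsub hy, heq]
    exact hp'
  have hlt : 0 < p.snd - δ := sub_pos.2 (lt_of_le_of_ne hge hne)
  have hval : hypPersp p.fst = ((p.snd - δ + δ : ℝ) : EReal) := by
    rw [sub_add_cancel]
    refine le_antisymm hp' ?_
    have hcoe := EReal.coe_toReal (ne_top_of_le_ne_top (EReal.coe_ne_top _) hp')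
      (hypPersp_ne_bot p.fst)
    have := hv' p.fst (hypPersp p.fst).toReal hcoe.ge
    rw [sub_self, inner_zero_right] at this
    rw [← hcoe, EReal.coe_le_coe_iff]
    nlinarith
  refine ⟨p.snd - δ, p.fst, hlt, hval, fun y r hy => ?_⟩
  have := hv' y r hy
  linarith

theorem proj_epi_of_not_le {x η δ : ℝ}
    (h : ¬ hypPersp (proj (closure (dom hypPersp)) (pt2 x η)) ≤ δ) :
    ∃ μ : ℝ, 0 < μ ∧
      ((μ + δ : ℝ) : EReal) - hypPersp (prox (scale μ hypPersp) (pt2 x η)) = 0 ∧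
      (∀ μ' : ℝ, 0 < μ' →
        ((μ' + δ : ℝ) : EReal) - hypPersp (prox (scale μ' hypPersp) (pt2 x η)) = 0 →
        μ' = μ) ∧
      (0 ≤ η ∧ x < η → μ ≤ -δ + η * x / (η - x)) ∧
      (η < 0 ∧ x ≤ -η → μ ≤ -δ) ∧
      proj (epi hypPersp) (pt3 (pt2 x η) δ) =
        pt3 (prox (scale μ hypPersp) (pt2 x η)) (δ + μ) := by
  obtain ⟨μ, p, hμ, hp⟩ := exists_isPerspProx_of_hypPersp_proj h
  have hprox := (hp.isProx hμ).prox_eq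
  refine ⟨μ, hμ, ?_, fun μ' hμ' h' => ?_, fun h' => ?_, fun h' => ?_, ?_⟩
  · rw [hprox, hp.value, ← EReal.coe_sub, sub_self, EReal.coe_zero]
  · obtain ⟨p', a, hp'⟩ := exists_isPerspProx hμ' (pt2 x η)
    rw [(hp'.isProx hμ').prox_eq, hp'.value, ← EReal.coe_sub] at h'
    have ha : a = μ' + δ := by
      have : μ' + δ - a = 0 := by exact_mod_cast h'
      linarith
    subst ha
    -- Both multipliers produce the projection onto the epigraph, whose height is `δ + μ`.
    have := hp'.proj_epi_eq
    rw [hp.proj_epi_eq] at this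
    have := congrArg (fun w => w.snd) this
    simp only [pt3_snd] at this
    linarith
  · have := hp.value_le hμ (hypPersp_proj_of_mem h'.1 h'.2).le
    linarith
  · have := hp.value_le (c := 0) hμ (hypPersp_proj_of_polar h'.1.le h'.2).le
    linarith
  · rw [hprox, hp.proj_epi_eq]

end HypCone

theorem mainTheorem6 :
    -- `f ∈ Γ₀(ℝ)`, and its recession function
    Gamma0 hyp ∧
    (∀ x₀ ∈ dom hyp, ∀ x : ℝ, Tendsto (diffQuot hyp x₀ x) atTop (𝓝 (recession hyp x))) ∧
    (∀ x : ℝ, recession hyp x = indicator (Set.Iic (0 : ℝ)) x) ∧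
    -- the perspective
    (∀ x η : ℝ,
      (0 < η ∧ x < η → hypPersp (pt2 x η) = ((η * x / (η - x) : ℝ) : EReal)) ∧
      (η = 0 → hypPersp (pt2 x η) = indicator (Set.Iic (0 : ℝ)) x) ∧
      (¬ (0 < η ∧ x < η) ∧ η ≠ 0 → hypPersp (pt2 x η) = ⊤)) ∧
    -- the closure of its domain, and the projection onto it
    closure (dom hypPersp) = {z | 0 ≤ z.snd ∧ z.fst ≤ z.snd} ∧
    (∀ z, IsProx (indicator (closure (dom hypPersp))) z (proj (closure (dom hypPersp)) z)) ∧
    (∀ x η : ℝ,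
      (η ≤ 0 ∧ x ≤ -η → proj (closure (dom hypPersp)) (pt2 x η) = pt2 (min 0 x) 0) ∧
      (|η| ≤ x → proj (closure (dom hypPersp)) (pt2 x η) = pt2 ((x + η) / 2) ((x + η) / 2)) ∧
      (¬ (η ≤ 0 ∧ x ≤ -η) ∧ ¬ |η| ≤ x →
        proj (closure (dom hypPersp)) (pt2 x η) = pt2 x η)) ∧
    -- the value of the perspective at the projection
    (∀ x η : ℝ,
      (η ≤ 0 ∧ x ≤ -η → hypPersp (proj (closure (dom hypPersp)) (pt2 x η)) = 0) ∧
      (0 ≤ η ∧ x < η →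
        hypPersp (proj (closure (dom hypPersp)) (pt2 x η)) = ((η * x / (η - x) : ℝ) : EReal)) ∧
      (¬ (η ≤ 0 ∧ x ≤ -η) ∧ ¬ (0 ≤ η ∧ x < η) →
        hypPersp (proj (closure (dom hypPersp)) (pt2 x η)) = ⊤)) ∧
    (∀ x η δ : ℝ,
      hypPersp (proj (closure (dom hypPersp)) (pt2 x η)) ≤ (δ : EReal) ↔
        (0 ≤ η ∧ x < η ∧ η * x / (η - x) ≤ δ) ∨ (η ≤ 0 ∧ x ≤ -η ∧ 0 ≤ δ)) ∧
    -- the projection onto the hyperbolic cone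
    (∀ w, IsProx (indicator (epi hypPersp)) w (proj (epi hypPersp) w)) ∧
    (∀ μ : ℝ, 0 < μ → ∀ z, IsProx (scale μ hypPersp) z (prox (scale μ hypPersp) z)) ∧
    (∀ x η δ : ℝ,
      (η ≤ 0 ∧ x ≤ -η ∧ 0 ≤ δ →
        proj (epi hypPersp) (pt3 (pt2 x η) δ) = pt3 (pt2 (min 0 x) 0) δ) ∧
      (0 ≤ η ∧ x < η ∧ η * x / (η - x) ≤ δ →
        proj (epi hypPersp) (pt3 (pt2 x η) δ) = pt3 (pt2 x η) δ) ∧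
      (¬ (η ≤ 0 ∧ x ≤ -η ∧ 0 ≤ δ) ∧ ¬ (0 ≤ η ∧ x < η ∧ η * x / (η - x) ≤ δ) →
        ∃ μ : ℝ, 0 < μ ∧
          ((μ + δ : ℝ) : EReal) - hypPersp (prox (scale μ hypPersp) (pt2 x η)) = 0 ∧
          (∀ μ' : ℝ, 0 < μ' →
            ((μ' + δ : ℝ) : EReal) - hypPersp (prox (scale μ' hypPersp) (pt2 x η)) = 0 →
            μ' = μ) ∧
          (0 ≤ η ∧ x < η → μ ≤ -δ + η * x / (η - x)) ∧
          (η < 0 ∧ x ≤ -η → μ ≤ -δ) ∧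
          proj (epi hypPersp) (pt3 (pt2 x η) δ) =
            pt3 (prox (scale μ hypPersp) (pt2 x η)) (δ + μ))) ∧
    -- the conjugate, the closure of its domain, and the projection onto it
    (∀ ξ : ℝ,
      (0 ≤ ξ → hypConj ξ = (((√ξ - 1) ^ 2 : ℝ) : EReal)) ∧
      (ξ < 0 → hypConj ξ = ⊤)) ∧
    closure (dom hypConj) = Set.Ici (0 : ℝ) ∧
    (∀ ξ, IsProx (indicator (closure (dom hypConj))) ξ (proj (closure (dom hypConj)) ξ)) ∧
    (∀ ξ : ℝ, proj (closure (dom hypConj)) ξ = max 0 ξ) ∧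
    (∀ ξ : ℝ,
      (0 ≤ ξ → hypConj (proj (closure (dom hypConj)) ξ) = (((√ξ - 1) ^ 2 : ℝ) : EReal)) ∧
      (ξ < 0 → hypConj (proj (closure (dom hypConj)) ξ) = 1)) ∧
    -- the proximity operators of `γ f` and `γ f*` through cubic equations
    (∀ γ : ℝ, 0 < γ → ∀ x : ℝ,
      IsProx (scale γ hyp) x (prox (scale γ hyp) x) ∧
      prox (scale γ hyp) x < 1 ∧
      (x - prox (scale γ hyp) x) * (1 - prox (scale γ hyp) x) ^ 2 - γ = 0 ∧
      (∀ p : ℝ, p < 1 → (x - p) * (1 - p) ^ 2 - γ = 0 → p = prox (scale γ hyp) x)) ∧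
    (∀ γ : ℝ, 0 < γ → ∀ x : ℝ,
      IsProx (scale γ hypConj) x (prox (scale γ hypConj) x) ∧
      max (x - γ) 0 < prox (scale γ hypConj) x ∧
      prox (scale γ hypConj) x ^ 3 + 2 * (γ - x) * prox (scale γ hypConj) x ^ 2
        + prox (scale γ hypConj) x * (γ - x) ^ 2 - γ ^ 2 = 0 ∧
      (∀ q : ℝ, max (x - γ) 0 < q →
        q ^ 3 + 2 * (γ - x) * q ^ 2 + q * (γ - x) ^ 2 - γ ^ 2 = 0 →
        q = prox (scale γ hypConj) x)) ∧
    -- the proximity operator of `μ f~`, and the value of the perspective there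
    (∀ μ : ℝ, 0 < μ → ∀ x η : ℝ,
      ((η : EReal) + (μ : EReal) * hypConj (proj (closure (dom hypConj)) (x / μ)) ≤ 0 ↔
        η + (√(max 0 x) - √μ) ^ 2 ≤ 0) ∧
      (η + (√(max 0 x) - √μ) ^ 2 ≤ 0 →
        prox (scale μ hypPersp) (pt2 x η) = pt2 (min 0 x) 0 ∧
        hypPersp (prox (scale μ hypPersp) (pt2 x η)) = 0) ∧
      (¬ η + (√(max 0 x) - √μ) ^ 2 ≤ 0 →
        ∃ ν : ℝ, 0 < ν ∧ ν ≤ η + (√(max 0 x) - √μ) ^ 2 ∧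
          (ν : EReal) =
            (η : EReal) + (μ : EReal) * hypConj (prox (scale (ν / μ) hypConj) (x / μ)) ∧
          ν = η + μ * (√(prox (scale (ν / μ) hypConj) (x / μ)) - 1) ^ 2 ∧
          (∀ ν' : ℝ, 0 < ν' →
            (ν' : EReal) =
              (η : EReal) + (μ : EReal) * hypConj (prox (scale (ν' / μ) hypConj) (x / μ)) →
            ν' = ν) ∧
          (∀ ν' : ℝ, 0 < ν' →
            ν' = η + μ * (√(prox (scale (ν' / μ) hypConj) (x / μ)) - 1) ^ 2 → ν' = ν) ∧
          prox (scale μ hypPersp) (pt2 x η) =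
            pt2 (x - μ * prox (scale (ν / μ) hypConj) (x / μ)) ν ∧
          hypPersp (prox (scale μ hypPersp) (pt2 x η)) =
            ((ν * (prox (scale (μ / ν) hyp) (x / ν) / (1 - prox (scale (μ / ν) hyp) (x / ν))) : ℝ) :
              EReal))) := by
  refine ⟨gamma0_hyp, fun x₀ hx₀ x => ?_, recession_hyp,
    fun x η => ⟨fun h => hypPersp_of_pos h.1 h.2, fun h => h ▸ hypPersp_zero x,
      fun h => hypPersp_eq_top h.1 h.2⟩,
    closure_dom_hypPersp, isProx_proj_dom,
    fun x η => ⟨fun h => proj_dom_of_polar h.1 h.2, proj_dom_of_abs_le, fun h => ?_⟩,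
    fun x η => ⟨fun h => hypPersp_proj_of_polar h.1 h.2, fun h => hypPersp_proj_of_mem h.1 h.2,
      fun h => hypPersp_proj_eq_top h.1 h.2⟩,
    hypPersp_proj_le_iff, isProx_proj_epi, fun μ hμ => isProx_prox_scale_hypPersp hμ,
    fun x η δ => ⟨fun h => proj_epi_of_polar h.1 h.2.1 h.2.2, fun h => proj_epi_of_mem ?_,
      fun h => proj_epi_of_not_le ?_⟩,
    fun ξ => ⟨hypConj_of_nonneg, hypConj_of_neg⟩, closure_dom_hypConj, fun ξ => ?_, fun ξ => ?_,
    fun ξ => ⟨fun h => ?_, fun h => ?_⟩, fun γ hγ => prox_scale_hyp_spec hγ,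
    fun γ hγ => prox_scale_hypConj_spec hγ,
    fun μ hμ x η => ⟨proj_condition_iff hμ x η, fun h => ?_, prox_scale_hypPersp_of_pos hμ⟩⟩
  · rw [recession_hyp]
    exact tendsto_diffQuot_hyp (mem_dom_hyp.1 hx₀) x
  · obtain ⟨h1, h2⟩ := mem_of_not_polar h.1 h.2
    exact proj_dom_of_mem h1 h2
  · rw [hypPersp_of_mem h.1 h.2.1, EReal.coe_le_coe_iff]
    exact h.2.2
  -- The remaining case is exactly `f~(P_D z) > δ`.
  · rw [hypPersp_proj_le_iff]
    exact fun h' => h'.elim h.2 h.1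
  · rw [closure_dom_hypConj]
    exact isProx_proj_Ici ξ
  · rw [closure_dom_hypConj, proj_Ici]
  · rw [closure_dom_hypConj, proj_Ici, max_eq_right h, hypConj_of_nonneg h]
  · rw [closure_dom_hypConj, proj_Ici, max_eq_left h.le, hypConj_of_nonneg le_rfl]
    simp
  · have hp := isPerspProx_of_nonpos hμ h
    rw [(hp.isProx hμ).prox_eq]
    exact ⟨rfl, hp.value⟩
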